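/- Fix an integer $M\ge 3$, a real $P>0$ and a real $\alpha$ with $0\le\alpha<1/4$. Consider the Gaussian channel $Y_i=X_i+Z_i$ with noisy feedback $\tilde Y_i=Y_i+\tilde Z_i$, where $Z_1,Z_2,\dots$ are i.i.d. $\mathrm N(0,1)$, $\tilde Z_1,\tilde Z_2,\dots$ are i.i.d. $\mathrm N(0,\alpha)$, and the two noise sequences are independent of each other. An $(M,n)$ code consists of (measurable) encoding functions $x_i(w,\tilde y^{\,i-1})$, $1\le i\le n$, $w\in\{1,\dots,M\}$, and a (measurable) decoding function $\hat w(y^n)$, subject to the peak energy constraint $$\mathsf P\Big\{\sum_{i=1}^n x_i^2(w,\tilde Y^{i-1})\le nP\Big\}=1\quad\text{for all } w,$$ where $\tilde Y^{i-1}$ is the noisy feedback produced when $w$ is sent. Its error probability is $P_e^{(n)}=\frac1M\sum_{w=1}^M\mathsf P\{\hat w(Y^n)\ne w\mid W=w\}$. Let $P_e^*(M,n)$ be the infimum of $P_e^{(n)}$ over all such codes and let $$E_M(\alpha)=\limsup_{n\to\infty}-\frac1n\ln P_e^*(M,n).$$ Let $E_M(\infty)$ be the corresponding quantity for codes without feedback,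 that is, with codewords $x^n(w)$ that depend on $w$ only and satisfy $\sum_{i=1}^n x_i^2(w)\le nP$. Then $$E_M(\infty)=\frac{M}{4(M-1)}P\qquad\text{and}\qquad E_M(\alpha)>E_M(\infty).$$ -/

import Mathlib

open MeasureTheory ProbabilityTheory Filter
open scoped NNReal ENNReal

/-- An `(M, n)` code for the channel with feedback. At (0-based) time `i` the encoder knows the
message `w` and the `i` noisy feedback symbols received so far; the decoder maps the `n` channel
outputs to a message. -/
structure FeedbackCode (M n : ℕ) where
  enc : (i : Fin n) → Fin M → (Fin i → ℝ) → ℝ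
  dec : (Fin n → ℝ) → Fin M
  measurable_enc : ∀ i w, Measurable (enc i w)
  measurable_dec : Measurable dec

/-- The law of the forward noise: `n` i.i.d. standard Gaussian variables. -/
noncomputable def forwardNoise (n : ℕ) : Measure (Fin n → ℝ) :=
  Measure.pi fun _ => gaussianReal 0 1

/-- The law of the backward noise: `n` i.i.d. centred Gaussian variables of variance `α`
(almost surely zero when `α = 0`). -/
noncomputable def backwardNoise (n : ℕ) (α : ℝ≥0) : Measure (Fin n → ℝ) :=
  Measure.pi fun _ => gaussianReal 0 α

/-- The joint law of the independent forward and backward noise sequences. -/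
noncomputable def noiseLaw (n : ℕ) (α : ℝ≥0) : Measure ((Fin n → ℝ) × (Fin n → ℝ)) :=
  (forwardNoise n).prod (backwardNoise n α)

namespace FeedbackCode

variable {M n : ℕ}

/-- The channel input at time `i` when the message is `w` and the forward and backward noise
sequences are `z` and `z'`. The feedback symbol of an earlier time `j` is
`(input at time j) + z j + z' j`. -/
noncomputable def input (c : FeedbackCode M n) (w : Fin M) (z z' : Fin n → ℝ) (i : Fin n) : ℝ :=
  c.enc i w fun j : Fin i =>
    c.input w z z' ⟨j, j.isLt.trans i.isLt⟩ + z ⟨j, j.isLt.trans i.isLt⟩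
      + z' ⟨j, j.isLt.trans i.isLt⟩
termination_by i.val
decreasing_by exact j.isLt

/-- The channel output: input plus forward noise. -/
noncomputable def output (c : FeedbackCode M n) (w : Fin M) (z z' : Fin n → ℝ) : Fin n → ℝ :=
  fun i => c.input w z z' i + z i

/-- The peak energy constraint: for every message, the energy of the transmitted block is at most
`n P` with probability one. -/
def PeakEnergy (c : FeedbackCode M n) (α : ℝ≥0) (P : ℝ) : Prop :=
  ∀ w : Fin M, ∀ᵐ ω ∂(noiseLaw n α), ∑ i, c.input w ω.1 ω.2 i ^ 2 ≤ (n : ℝ) * P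

/-- The probability of a decoding error for a uniformly distributed message. -/
noncomputable def errorProb (c : FeedbackCode M n) (α : ℝ≥0) : ℝ≥0∞ :=
  (M : ℝ≥0∞)⁻¹ * ∑ w : Fin M, noiseLaw n α {ω | c.dec (c.output w ω.1 ω.2) ≠ w}

end FeedbackCode

/-- An `(M, n)` code for the channel without feedback. -/
structure BlockCode (M n : ℕ) where
  enc : Fin M → Fin n → ℝ
  dec : (Fin n → ℝ) → Fin M
  measurable_dec : Measurable dec

namespace BlockCode

variable {M n : ℕ}

/-- The peak energy constraint: every codeword has energy at most `n P`. -/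
def PeakEnergy (c : BlockCode M n) (P : ℝ) : Prop :=
  ∀ w : Fin M, ∑ i, c.enc w i ^ 2 ≤ (n : ℝ) * P

/-- The probability of a decoding error for a uniformly distributed message. -/
noncomputable def errorProb (c : BlockCode M n) : ℝ≥0∞ :=
  (M : ℝ≥0∞)⁻¹ * ∑ w : Fin M, forwardNoise n {z | c.dec (fun i => c.enc w i + z i) ≠ w}

end BlockCode

/-- The best (infimal) error probability over `(M, n)` codes with feedback noise power `α` that
satisfy the peak energy constraint. -/
noncomputable def bestErrorProb (M n : ℕ) (α : ℝ≥0) (P : ℝ) : ℝ≥0∞ :=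
  ⨅ (c : FeedbackCode M n) (_ : c.PeakEnergy α P), c.errorProb α

/-- The best (infimal) error probability over `(M, n)` codes without feedback that satisfy the
peak energy constraint. -/
noncomputable def bestErrorProbNoFeedback (M n : ℕ) (P : ℝ) : ℝ≥0∞ :=
  ⨅ (c : BlockCode M n) (_ : c.PeakEnergy P), c.errorProb

/-- The best error exponent `E_M(α)`: the limit superior of `-(1/n) ln` of the best error
probability, as an extended real number (with `ln 0 = -∞`). -/
noncomputable def errorExponent (M : ℕ) (α : ℝ≥0) (P : ℝ) : EReal :=
  limsup (fun n : ℕ => -ENNReal.log (bestErrorProb M n α P) / (n : EReal)) atTop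

/-- The best error exponent `E_M(∞)` without feedback. -/
noncomputable def errorExponentNoFeedback (M : ℕ) (P : ℝ) : EReal :=
  limsup (fun n : ℕ => -ENNReal.log (bestErrorProbNoFeedback M n P) / (n : EReal)) atTop

/-! Without feedback, averaging squared distances over pairs of codewords gives a pair at squared
distance at most `2M(nP)/(M-1)` (`exists_sum_sub_sq_le`). Testing between two Gaussian translates at
distance `2L` costs at least about `exp(-L²/2)`, up to a factor `exp(-O(L))`
(`exp_le_forwardNoise_add_forwardNoise`). This is the converse, and simplex signalling attains it by
a union bound over pairs.

With feedback, most of the energy goes to a simplex and a little to one antipodal symbol that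
separates the two messages leading in the feedback. Energy in an antipodal signal buys exponent at
rate `1/2`, energy in a simplex only at rate `M/(4(M-1))`, which is smaller exactly when `M > 2`.
With amplitudes `10b` and `b` the error is of order `exp(-(25 + 1/2)b²)`, at energy `(100(1 - 1/M) +
1)b²`.

The danger is that noise in the feedback gives a wrong leading pair, so that the last symbol hurts.
An error then needs two noise events at once: a near-error in the forward channel and a third
message overtaking in the feedback. For `α ≤ 1/4` a Chernoff bound on a suitable linear combination
of the two shows that this joint event is no likelier than the bound `exp(-(51/2)b²)` for the
ordinary error (`noiseLaw_overtaking_rival_le`, `noiseLaw_overtaking_sender_le`). -/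

instance isProbabilityMeasure_forwardNoise (n : ℕ) : IsProbabilityMeasure (forwardNoise n) := by
  unfold forwardNoise; infer_instance

instance isProbabilityMeasure_backwardNoise (n : ℕ) (α : ℝ≥0) :
    IsProbabilityMeasure (backwardNoise n α) := by
  unfold backwardNoise; infer_instance

instance isProbabilityMeasure_noiseLaw (n : ℕ) (α : ℝ≥0) :
    IsProbabilityMeasure (noiseLaw n α) := by
  unfold noiseLaw; infer_instance

/-! ### Gaussian tail bounds for linear functionals of the noise -/

theorem HasSubgaussianMGF.mono {Ω : Type*} {m : MeasurableSpace Ω} {μ : Measure Ω} {X : Ω → ℝ}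
    {c d : ℝ≥0} (h : HasSubgaussianMGF X c μ) (hcd : c ≤ d) : HasSubgaussianMGF X d μ where
  integrable_exp_mul := h.integrable_exp_mul
  mgf_le t := (h.mgf_le t).trans (by gcongr)

theorem hasSubgaussianMGF_id_gaussianReal (v : ℝ≥0) :
    HasSubgaussianMGF (fun x : ℝ => x) v (gaussianReal 0 v) where
  integrable_exp_mul t := integrable_exp_mul_gaussianReal t
  mgf_le t := by rw [mgf_fun_id_gaussianReal]; simp

theorem hasSubgaussianMGF_linear_pi_gaussianReal {n : ℕ} {ι : Type*} [Fintype ι] (v : ℝ≥0)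
    {e : ι → Fin n} (he : Function.Injective e) (q : ι → ℝ) :
    HasSubgaussianMGF (fun z : Fin n → ℝ => ∑ l, q l * z (e l))
      (∑ l, ⟨q l ^ 2, sq_nonneg _⟩ * v) (Measure.pi fun _ => gaussianReal 0 v) := by
  have hind : iIndepFun (fun (i : Fin n) (z : Fin n → ℝ) => z i)
      (Measure.pi fun _ => gaussianReal 0 v) :=
    iIndepFun_pi (X := fun _ x => x) fun _ => aemeasurable_id
  refine HasSubgaussianMGF.sum_of_iIndepFun
    ((hind.precomp he).comp (fun l x => q l * x) fun l => measurable_const_mul _) fun l _ => ?_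
  refine HasSubgaussianMGF.const_mul (X := fun z : Fin n → ℝ => z (e l)) ?_ (q l)
  have := HasSubgaussianMGF.of_map (μ := Measure.pi fun _ : Fin n => gaussianReal 0 v)
    (Y := fun z => z (e l)) (X := fun x => x) (c := v) (measurable_pi_apply _).aemeasurable
    (by rw [(measurePreserving_eval (fun _ : Fin n => gaussianReal 0 v) (e l)).map_eq]
        exact hasSubgaussianMGF_id_gaussianReal v)
  exact this

/-- Chernoff's bound; every error estimate below reduces to it. Injectivity of `e` and `f` makes the
selected coordinates independent. The sub-Gaussian form covers `α = 0`, where the backward noise has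
no density. -/
theorem noiseLaw_linear_tail {n : ℕ} {ι κ : Type*} [Fintype ι] [Fintype κ] (α : ℝ≥0)
    {e : ι → Fin n} (he : Function.Injective e) {f : κ → Fin n} (hf : Function.Injective f)
    (q : ι → ℝ) (r : κ → ℝ) {t v : ℝ} (ht : 0 ≤ t)
    (hv : ∑ l, q l ^ 2 + α * ∑ l, r l ^ 2 ≤ v) :
    noiseLaw n α {ω | t ≤ ∑ l, q l * ω.1 (e l) + ∑ l, r l * ω.2 (f l)} ≤
      ENNReal.ofReal (Real.exp (-t ^ 2 / (2 * v))) := by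
  have h1 := HasSubgaussianMGF.of_map (μ := noiseLaw n α) (Y := Prod.fst)
    measurable_fst.aemeasurable (by
      rw [noiseLaw, Measure.map_fst_prod, measure_univ, one_smul]
      exact hasSubgaussianMGF_linear_pi_gaussianReal 1 he q)
  have h2 := HasSubgaussianMGF.of_map (μ := noiseLaw n α) (Y := Prod.snd)
    measurable_snd.aemeasurable (by
      rw [noiseLaw, Measure.map_snd_prod, measure_univ, one_smul]
      exact hasSubgaussianMGF_linear_pi_gaussianReal α hf r)
  have hind : IndepFun ((fun z : Fin n → ℝ => ∑ l, q l * z (e l)) ∘ Prod.fst)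
      ((fun z : Fin n → ℝ => ∑ l, r l * z (f l)) ∘ Prod.snd) (noiseLaw n α) :=
    indepFun_prod (X := fun z : Fin n → ℝ => ∑ l, q l * z (e l))
      (Y := fun z : Fin n → ℝ => ∑ l, r l * z (f l)) (by fun_prop) (by fun_prop)
  have hv0 : 0 ≤ v := le_trans (by positivity) hv
  have h := (HasSubgaussianMGF.mono (h1.add_of_indepFun h2 hind) (d := v.toNNReal) (by
    rw [← NNReal.coe_le_coe, Real.coe_toNNReal _ hv0]
    refine le_trans (le_of_eq ?_) hv
    push_cast
    rw [Finset.mul_sum]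
    congr 1
    · exact Finset.sum_congr rfl fun l _ => mul_one _
    · exact Finset.sum_congr rfl fun l _ => mul_comm _ _)).measure_ge_le ht
  rw [Real.coe_toNNReal _ hv0] at h
  rw [← ENNReal.ofReal_toReal (measure_ne_top (noiseLaw n α) _)]
  exact ENNReal.ofReal_le_ofReal h

theorem forwardNoise_linear_tail {n : ℕ} {ι : Type*} [Fintype ι]
    {e : ι → Fin n} (he : Function.Injective e)
    (q : ι → ℝ) {t v : ℝ} (ht : 0 ≤ t) (hv : ∑ l, q l ^ 2 ≤ v) :
    forwardNoise n {z | t ≤ ∑ l, q l * z (e l)} ≤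
      ENNReal.ofReal (Real.exp (-t ^ 2 / (2 * v))) := by
  have h := noiseLaw_linear_tail 0 he (f := (Fin.elim0 : Fin 0 → Fin n))
    (fun i => i.elim0) q Fin.elim0 ht (by simpa using hv)
  refine le_trans (le_of_eq ?_) h
  have hm : MeasurableSet {z : Fin n → ℝ | t ≤ ∑ l, q l * z (e l)} :=
    measurableSet_le measurable_const (by fun_prop)
  conv_lhs => rw [← one_smul ℝ≥0∞ (forwardNoise n), ← measure_univ (μ := backwardNoise n 0),
    ← Measure.map_fst_prod, Measure.map_apply measurable_fst hm]
  simp [noiseLaw, Set.preimage]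

/-! ### Exponential rates -/

/-- The term `K * √n` leaves room for the subexponential loss in the converse. -/
theorem tendsto_neg_log_div (C E K : ℝ) (hC : 0 < C) :
    Tendsto (fun n : ℕ => -ENNReal.log (ENNReal.ofReal (C * Real.exp (-(n * E + K * √n)))) /
      (n : EReal)) atTop (nhds (E : EReal)) := by
  have h1 : Tendsto (fun n : ℕ => E + (K * (√n)⁻¹ - Real.log C * (n : ℝ)⁻¹)) atTop (nhds E) := by
    have h2 : Tendsto (fun n : ℕ => (√(n : ℝ))⁻¹) atTop (nhds 0) :=
      tendsto_inv_atTop_zero.comp (Real.tendsto_sqrt_atTop.comp tendsto_natCast_atTop_atTop)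
    have h3 : Tendsto (fun n : ℕ => ((n : ℝ))⁻¹) atTop (nhds 0) :=
      tendsto_inv_atTop_zero.comp tendsto_natCast_atTop_atTop
    simpa using ((h2.const_mul K).sub (h3.const_mul (Real.log C))).const_add E
  refine ((continuous_coe_real_ereal.tendsto E).comp h1).congr' ?_
  filter_upwards [eventually_gt_atTop 0] with n hn
  have hn' : (0 : ℝ) < n := by exact_mod_cast hn
  rw [ENNReal.log_ofReal_of_pos (by positivity), Real.log_mul hC.ne' (Real.exp_ne_zero _),
    Real.log_exp, ← EReal.coe_neg, ← EReal.coe_natCast, ← EReal.coe_div]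
  simp only [Function.comp]
  congr 1
  have hs : √(n : ℝ) * √n = n := Real.mul_self_sqrt hn'.le
  have hs0 : (√(n : ℝ))⁻¹ = √n * (n : ℝ)⁻¹ := by
    have : 0 < √(n : ℝ) := Real.sqrt_pos.2 hn'
    field_simp
    linarith
  rw [hs0]
  field_simp
  ring

theorem le_limsup_neg_log_div {p : ℕ → ℝ≥0∞} (C E : ℝ) (hC : 0 < C)
    (h : ∀ᶠ n : ℕ in atTop, p n ≤ ENNReal.ofReal (C * Real.exp (-(n * E)))) :
    (E : EReal) ≤ limsup (fun n : ℕ => -ENNReal.log (p n) / (n : EReal)) atTop := by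
  rw [← (tendsto_neg_log_div C E 0 hC).limsup_eq]
  refine limsup_le_limsup ?_
  filter_upwards [h] with n hn
  refine EReal.div_le_div_right_of_nonneg (by positivity) (EReal.neg_le_neg_iff.2 ?_)
  exact ENNReal.log_le_log (by simpa using hn)

theorem limsup_neg_log_div_le {p : ℕ → ℝ≥0∞} (C E K : ℝ) (hC : 0 < C)
    (h : ∀ᶠ n : ℕ in atTop, ENNReal.ofReal (C * Real.exp (-(n * E + K * √n))) ≤ p n) :
    limsup (fun n : ℕ => -ENNReal.log (p n) / (n : EReal)) atTop ≤ (E : EReal) := by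
  rw [← (tendsto_neg_log_div C E K hC).limsup_eq]
  refine limsup_le_limsup ?_
  filter_upwards [h] with n hn
  exact EReal.div_le_div_right_of_nonneg (by positivity)
    (EReal.neg_le_neg_iff.2 (ENNReal.log_le_log hn))

/-! ### Testing two translates of the Gaussian law -/

theorem gaussianReal_eq_withDensity (δ : ℝ) :
    gaussianReal δ 1 = (gaussianReal 0 1).withDensity
      (fun x => ENNReal.ofReal (Real.exp (δ * x - δ ^ 2 / 2))) := by
  rw [gaussianReal_of_var_ne_zero _ one_ne_zero, gaussianReal_of_var_ne_zero _ one_ne_zero,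
    ← withDensity_mul _ (measurable_gaussianPDF _ _) (by fun_prop)]
  congr 1
  ext x
  rw [Pi.mul_apply, gaussianPDF, gaussianPDF, ← ENNReal.ofReal_mul (gaussianPDFReal_nonneg _ _ _),
    gaussianPDFReal, gaussianPDFReal, mul_assoc _ (Real.exp _) (Real.exp _), ← Real.exp_add]
  congr 3
  push_cast
  ring

theorem pi_gaussianReal_eq_withDensity {n : ℕ} (δ : Fin n → ℝ) :
    (Measure.pi fun i => gaussianReal (δ i) 1) = (forwardNoise n).withDensity
      (fun z => ∏ i, ENNReal.ofReal (Real.exp (δ i * z i - δ i ^ 2 / 2))) := by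
  refine Measure.pi_eq fun s hs => ?_
  rw [withDensity_apply _ (MeasurableSet.univ_pi hs), forwardNoise, ← lintegral_indicator
    (MeasurableSet.univ_pi hs)]
  -- On a box the indicator splits into coordinate indicators, so independence factors the integral.
  have hind : iIndepFun (fun (i : Fin n) (z : Fin n → ℝ) => (s i).indicator
      (fun x => ENNReal.ofReal (Real.exp (δ i * x - δ i ^ 2 / 2))) (z i))
      (Measure.pi fun _ => gaussianReal 0 1) :=
    iIndepFun_pi (X := fun i => (s i).indicator
      (fun x => ENNReal.ofReal (Real.exp (δ i * x - δ i ^ 2 / 2)))) fun i =>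
      (Measurable.indicator (by fun_prop) (hs i)).aemeasurable
  have hmeas : ∀ i, Measurable ((s i).indicator
      (fun x => ENNReal.ofReal (Real.exp (δ i * x - δ i ^ 2 / 2)))) := fun i =>
    Measurable.indicator (by fun_prop) (hs i)
  calc _ = ∫⁻ z : Fin n → ℝ, (∏ i, (s i).indicator
      (fun x => ENNReal.ofReal (Real.exp (δ i * x - δ i ^ 2 / 2))) (z i)) ∂(Measure.pi fun _ => gaussianReal 0 1) := by
        refine lintegral_congr fun z => ?_
        by_cases hz : z ∈ Set.univ.pi s
        · rw [Set.indicator_of_mem hz]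
          exact Finset.prod_congr rfl fun i _ => by
            rw [Set.indicator_of_mem (hz i (Set.mem_univ i))]
        · rw [Set.indicator_of_notMem hz]
          simp only [Set.mem_pi, Set.mem_univ, true_imp_iff, not_forall] at hz
          obtain ⟨i, hi⟩ := hz
          exact (Finset.prod_eq_zero (Finset.mem_univ i) (Set.indicator_of_notMem hi _)).symm
    _ = ∏ i, ∫⁻ z : Fin n → ℝ, (s i).indicator
      (fun x => ENNReal.ofReal (Real.exp (δ i * x - δ i ^ 2 / 2))) (z i) ∂(Measure.pi fun _ => gaussianReal 0 1) :=
        lintegral_prod_eq_prod_lintegral_of_indepFun _ _ hind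
          fun i => (hmeas i).comp (measurable_pi_apply i)
    _ = _ := by
        refine Finset.prod_congr rfl fun i _ => ?_
        rw [(measurePreserving_eval (fun _ : Fin n => gaussianReal 0 1) i).lintegral_comp
          (hmeas i), lintegral_indicator (hs i), gaussianReal_eq_withDensity (δ i),
          withDensity_apply _ (hs i)]

theorem forwardNoise_map_add {n : ℕ} (δ : Fin n → ℝ) :
    (forwardNoise n).map (fun z i => δ i + z i) = Measure.pi fun i => gaussianReal (δ i) 1 := by
  rw [forwardNoise, Measure.pi_map_pi (f := fun i x => δ i + x)
    fun i => (measurable_const_add _).aemeasurable]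
  congr 1
  ext1 i
  simpa using gaussianReal_map_const_add (μ := 0) (v := 1) (δ i)

/-- The translated law has density `exp(⟨δ, z⟩ - |δ|²/2)`, which is at least `exp(-2L - L²/2)`
wherever `⟨δ, z⟩ ≥ -2L`. -/
theorem exp_mul_forwardNoise_le {n : ℕ} (δ : Fin n → ℝ) {L : ℝ} (hδ : ∑ i, δ i ^ 2 ≤ L ^ 2)
    {D : Set (Fin n → ℝ)} (hD : MeasurableSet D) :
    ENNReal.ofReal (Real.exp (-(L ^ 2 / 2 + 2 * L))) *
        forwardNoise n (D ∩ {z | -(2 * L) ≤ ∑ i, δ i * z i}) ≤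
      forwardNoise n {z | (fun i => δ i + z i) ∈ D} := by
  have hA : MeasurableSet {z : Fin n → ℝ | -(2 * L) ≤ ∑ i, δ i * z i} :=
    measurableSet_le measurable_const (by fun_prop)
  have hmap : forwardNoise n {z | (fun i => δ i + z i) ∈ D} =
      (Measure.pi fun i => gaussianReal (δ i) 1) D := by
    rw [← forwardNoise_map_add, Measure.map_apply (by fun_prop) hD]
    rfl
  rw [hmap, pi_gaussianReal_eq_withDensity, withDensity_apply _ hD, ← setLIntegral_const]
  refine (setLIntegral_mono' (hD.inter hA) fun z hz => ?_).trans
    (lintegral_mono_set Set.inter_subset_left)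
  rw [← ENNReal.ofReal_prod_of_nonneg fun i _ => (Real.exp_pos _).le, ← Real.exp_sum]
  refine ENNReal.ofReal_le_ofReal (Real.exp_le_exp.2 ?_)
  rw [Finset.sum_sub_distrib, ← Finset.sum_div]
  have := hz.2
  simp only [Set.mem_ofPred_eq] at this
  linarith

/-- A deviation of at least two standard deviations has probability at most `exp(-2) ≤ 1/4`, since
`e ≥ 2`. -/
theorem forwardNoise_linear_lt {n : ℕ} (δ : Fin n → ℝ) {L : ℝ} (hL : 0 < L)
    (hδ : ∑ i, δ i ^ 2 ≤ L ^ 2) :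
    forwardNoise n {z | ∑ i, δ i * z i < -(2 * L)} ≤ 4⁻¹ := by
  have h := forwardNoise_linear_tail (n := n) Function.injective_id (fun i => -δ i)
    (t := 2 * L) (v := L ^ 2) (by positivity) (by simpa using hδ)
  refine (measure_mono fun z hz => ?_).trans (h.trans ?_)
  · simp only [Set.mem_ofPred_eq, id, neg_mul, Finset.sum_neg_distrib] at hz ⊢
    linarith
  · have h4 : (4⁻¹ : ℝ≥0∞) = ENNReal.ofReal (4⁻¹) := by
      rw [ENNReal.ofReal_inv_of_pos (by norm_num), ENNReal.ofReal_ofNat]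
    rw [h4]
    refine ENNReal.ofReal_le_ofReal ?_
    have he : -(2 * L) ^ 2 / (2 * L ^ 2) = -2 := by field_simp
    rw [he, Real.exp_neg]
    refine inv_anti₀ (by norm_num) ?_
    have h1 := Real.add_one_le_exp (1 : ℝ)
    have h2 : Real.exp 2 = Real.exp 1 * Real.exp 1 := by rw [← Real.exp_add]; norm_num
    nlinarith

/-- Both hypotheses are compared with the Gaussian law centred at the midpoint, so each shift has
length at most `L`. Under that law `D` and its complement share mass `1`, and discarding the two
exceptional half-spaces loses at most `1/4 + 1/4`. -/
theorem exp_le_forwardNoise_add_forwardNoise {n : ℕ} (u v : Fin n → ℝ) {L : ℝ} (hL : 0 < L)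
    (huv : ∑ i, (u i - v i) ^ 2 ≤ 4 * L ^ 2) {D : Set (Fin n → ℝ)} (hD : MeasurableSet D) :
    ENNReal.ofReal (Real.exp (-(L ^ 2 / 2 + 2 * L))) * 2⁻¹ ≤
      forwardNoise n {z | (fun i => u i + z i) ∈ D} +
        forwardNoise n {z | (fun i => v i + z i) ∈ Dᶜ} := by
  set δ : Fin n → ℝ := fun i => (u i - v i) / 2 with hδdef
  set D' : Set (Fin n → ℝ) := {y | (fun i => (u i + v i) / 2 + y i) ∈ D} with hD'def
  have hD' : MeasurableSet D' := by
    have : Measurable fun (y : Fin n → ℝ) i => (u i + v i) / 2 + y i := by fun_prop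
    exact this hD
  have hδ : ∑ i, δ i ^ 2 ≤ L ^ 2 := by
    simp only [hδdef, div_pow, ← Finset.sum_div]
    linarith
  have hδ' : ∑ i, (-δ i) ^ 2 ≤ L ^ 2 := by simpa using hδ
  have h1 := exp_mul_forwardNoise_le δ hδ hD'
  have h2 := exp_mul_forwardNoise_le (fun i => -δ i) hδ' hD'.compl
  have e1 : {z : Fin n → ℝ | (fun i => δ i + z i) ∈ D'} = {z | (fun i => u i + z i) ∈ D} := by
    ext z
    simp only [hD'def, hδdef, Set.mem_ofPred_eq]
    apply iff_of_eq; congr 1; ext i; ring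
  have e2 : {z : Fin n → ℝ | (fun i => -δ i + z i) ∈ D'ᶜ} =
      {z | (fun i => v i + z i) ∈ Dᶜ} := by
    ext z
    simp only [hD'def, hδdef, Set.mem_ofPred_eq, Set.mem_compl_iff]
    apply iff_of_eq; congr 2; ext i; ring
  rw [e1] at h1
  rw [e2] at h2
  refine le_trans ?_ (add_le_add h1 h2)
  rw [← mul_add]
  refine mul_le_mul_right ?_ _
  have t1 := forwardNoise_linear_lt δ hL hδ
  have t2 := forwardNoise_linear_lt (fun i => -δ i) hL hδ'
  set A := D' ∩ {z : Fin n → ℝ | -(2 * L) ≤ ∑ i, δ i * z i}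
  set B := D'ᶜ ∩ {z : Fin n → ℝ | -(2 * L) ≤ ∑ i, -δ i * z i}
  have hcover : (Set.univ : Set (Fin n → ℝ)) ⊆ (A ∪ B) ∪
      ({z | ∑ i, δ i * z i < -(2 * L)} ∪ {z | ∑ i, -δ i * z i < -(2 * L)}) := by
    intro z _
    rcases lt_or_ge (∑ i, δ i * z i) (-(2 * L)) with ha | ha
    · exact Or.inr (Or.inl ha)
    rcases lt_or_ge (∑ i, -δ i * z i) (-(2 * L)) with hb | hb
    · exact Or.inr (Or.inr hb)
    by_cases hz : z ∈ D'
    · exact Or.inl (Or.inl ⟨hz, ha⟩)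
    · exact Or.inl (Or.inr ⟨hz, hb⟩)
  have hone : (1 : ℝ≥0∞) ≤ (forwardNoise n A + forwardNoise n B) + (4⁻¹ + 4⁻¹) := by
    rw [← measure_univ (μ := forwardNoise n)]
    exact (measure_mono hcover).trans ((measure_union_le _ _).trans
      (add_le_add (measure_union_le _ _) ((measure_union_le _ _).trans (add_le_add t1 t2))))
  have h42 : (4⁻¹ : ℝ≥0∞) + 4⁻¹ = 2⁻¹ := by
    rw [← two_mul, show (4 : ℝ≥0∞) = 2 * 2 by norm_num, ENNReal.mul_inv (by simp) (by simp),
      ← mul_assoc, ENNReal.mul_inv_cancel (by simp) (by simp), one_mul]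
  rw [h42, ← ENNReal.inv_two_add_inv_two] at hone
  exact (ENNReal.add_le_add_iff_right (by simp)).1 hone

/-! ### Converse without feedback -/

theorem sum_sum_sub_sq_le {ι : Type*} [Fintype ι] (x : ι → ℝ) :
    ∑ w, ∑ w', (x w - x w') ^ 2 ≤ 2 * Fintype.card ι * ∑ w, x w ^ 2 := by
  have h : ∑ w, ∑ w', (x w - x w') ^ 2 =
      2 * Fintype.card ι * ∑ w, x w ^ 2 - 2 * (∑ w, x w) ^ 2 := by
    simp only [sub_sq, Finset.sum_add_distrib, Finset.sum_sub_distrib, Finset.sum_const,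
      Finset.card_univ, nsmul_eq_mul, ← Finset.mul_sum, ← Finset.sum_mul]
    ring
  rw [h]
  nlinarith [sq_nonneg (∑ w, x w)]

/-- The sum over all ordered pairs is at most `2M · MA`; the minimum is at most the average over the
`M(M-1)` off-diagonal ones. -/
theorem exists_sum_sub_sq_le {M n : ℕ} (hM : 2 ≤ M) (x : Fin M → Fin n → ℝ) {A : ℝ}
    (hx : ∀ w, ∑ i, x w i ^ 2 ≤ A) :
    ∃ u v, u ≠ v ∧ ∑ i, (x u i - x v i) ^ 2 ≤ 2 * M * A / (M - 1) := by
  have hM' : (0 : ℝ) < M - 1 := by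
    have : (2 : ℝ) ≤ M := by exact_mod_cast hM
    linarith
  have hne : (Finset.univ.offDiag : Finset (Fin M × Fin M)).Nonempty :=
    ⟨(⟨0, by omega⟩, ⟨1, by omega⟩), by simp⟩
  have hsum : ∑ p ∈ (Finset.univ.offDiag : Finset (Fin M × Fin M)),
      ∑ i, (x p.1 i - x p.2 i) ^ 2 ≤
      ∑ p ∈ (Finset.univ.offDiag : Finset (Fin M × Fin M)), 2 * M * A / ((M : ℝ) - 1) := by
    calc _ ≤ ∑ p : Fin M × Fin M, ∑ i, (x p.1 i - x p.2 i) ^ 2 :=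
          Finset.sum_le_sum_of_subset_of_nonneg (Finset.subset_univ _)
            fun _ _ _ => Finset.sum_nonneg fun _ _ => sq_nonneg _
      _ = ∑ i, ∑ w, ∑ w', (x w i - x w' i) ^ 2 := by
          rw [Finset.sum_comm]
          exact Finset.sum_congr rfl fun i _ => Fintype.sum_prod_type _
      _ ≤ ∑ i, 2 * (M : ℝ) * ∑ w, x w i ^ 2 :=
          Finset.sum_le_sum fun i _ => by simpa using sum_sum_sub_sq_le fun w => x w i
      _ = 2 * (M : ℝ) * ∑ w, ∑ i, x w i ^ 2 := by
          rw [← Finset.mul_sum, Finset.sum_comm]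
      _ ≤ 2 * (M : ℝ) * ∑ _w : Fin M, A := by
          gcongr with w
          exact hx w
      _ = _ := by
          rw [Finset.sum_const, Finset.sum_const, Finset.offDiag_card]
          simp only [Finset.card_univ, Fintype.card_fin, nsmul_eq_mul]
          rw [Nat.cast_sub (Nat.le_mul_self M)]
          push_cast
          field_simp
  obtain ⟨p, hp, hle⟩ := Finset.exists_le_of_sum_le hne hsum
  exact ⟨p.1, p.2, (Finset.mem_offDiag.1 hp).2.2, hle⟩

theorem BlockCode.le_errorProb {M n : ℕ} (hM : 2 ≤ M) (c : BlockCode M n) {P L : ℝ}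
    (hc : c.PeakEnergy P) (hL : 0 < L) (hL2 : 2 * M * (n * P) / (M - 1) ≤ 4 * L ^ 2) :
    ENNReal.ofReal ((2 * M : ℝ)⁻¹ * Real.exp (-(L ^ 2 / 2 + 2 * L))) ≤ c.errorProb := by
  obtain ⟨u, v, huv, hd⟩ := exists_sum_sub_sq_le hM c.enc hc
  have hD : MeasurableSet {y | c.dec y ≠ u} :=
    c.measurable_dec (MeasurableSet.of_discrete (s := {u}ᶜ))
  have h := exp_le_forwardNoise_add_forwardNoise (c.enc u) (c.enc v) hL (hd.trans hL2) hD
  have hM0 : (0 : ℝ) < M := by exact_mod_cast (by omega : 0 < M)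
  rw [BlockCode.errorProb, mul_inv, mul_comm (2 : ℝ)⁻¹, mul_assoc,
    ENNReal.ofReal_mul (by positivity), ENNReal.ofReal_inv_of_pos hM0, ENNReal.ofReal_natCast,
    mul_comm (2 : ℝ)⁻¹, ENNReal.ofReal_mul (by positivity),
    ENNReal.ofReal_inv_of_pos (by norm_num), ENNReal.ofReal_ofNat]
  refine mul_le_mul_right (h.trans ?_) _
  -- Deciding for `u` is an error when `v` was sent.
  have h2 : forwardNoise n {z | (fun i => c.enc v i + z i) ∈ {y | c.dec y ≠ u}ᶜ} ≤
      forwardNoise n {z | c.dec (fun i => c.enc v i + z i) ≠ v} := by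
    refine measure_mono fun z hz => ?_
    simp only [Set.mem_ofPred_eq, Set.mem_compl_iff, not_not] at hz ⊢
    rw [hz]
    exact huv
  refine (add_le_add le_rfl h2).trans ?_
  refine le_trans (le_of_eq (Finset.sum_pair (f := fun w => forwardNoise n
    {z | c.dec (fun i => c.enc w i + z i) ≠ w}) huv).symm) ?_
  exact Finset.sum_le_sum_of_subset (Finset.subset_univ _)

theorem errorExponentNoFeedback_le {M : ℕ} (hM : 2 ≤ M) {P : ℝ} (hP : 0 < P) :
    errorExponentNoFeedback M P ≤ (((M : ℝ) / (4 * ((M : ℝ) - 1)) * P : ℝ) : EReal) := by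
  have hM2 : (2 : ℝ) ≤ M := by exact_mod_cast hM
  have hM' : (0 : ℝ) < M - 1 := by linarith
  have hκ : 0 < M * P / (2 * ((M : ℝ) - 1)) := by positivity
  -- With `L² = nMP/(2(M-1))`, the term `L²/2` gives the rate and `2L` gives the coefficient of
  -- `√n`.
  refine limsup_neg_log_div_le (2 * M : ℝ)⁻¹ _ (2 * √(M * P / (2 * ((M : ℝ) - 1))))
    (by positivity) ?_
  filter_upwards [eventually_gt_atTop 0] with n hn
  have hn' : (0 : ℝ) < n := by exact_mod_cast hn
  refine le_iInf₂ fun c hc => ?_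
  have hs : (√(M * P / (2 * ((M : ℝ) - 1))) * √n) ^ 2 = M * P / (2 * ((M : ℝ) - 1)) * n := by
    rw [mul_pow, Real.sq_sqrt hκ.le, Real.sq_sqrt hn'.le]
  refine le_trans (le_of_eq ?_) (c.le_errorProb hM hc
    (mul_pos (Real.sqrt_pos.2 hκ) (Real.sqrt_pos.2 hn')) (le_of_eq ?_))
  · rw [hs]
    congr 4
    field_simp
    ring
  · rw [hs]
    field_simp
    ring

/-! ### Simplex signalling -/

/-- The `w`-th vertex of the regular simplex with `M` vertices, as a sequence supported on the first
`M` times. -/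
noncomputable def simplexVertex (M w i : ℕ) : ℝ :=
  if i < M then (if i = w then 1 else 0) - (M : ℝ)⁻¹ else 0

theorem sum_simplexVertex_sq {M n w : ℕ} (hw : w < M) (hn : M ≤ n) :
    ∑ i : Fin n, simplexVertex M w i ^ 2 = 1 - (M : ℝ)⁻¹ := by
  have hM : (M : ℝ) ≠ 0 := by exact_mod_cast (by omega : M ≠ 0)
  rw [Fin.sum_univ_eq_sum_range (fun i => simplexVertex M w i ^ 2) n,
    ← Finset.sum_subset (Finset.range_subset_range.2 hn)]
  · have h : ∀ i ∈ Finset.range M, simplexVertex M w i ^ 2 =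
        (if i = w then 1 - 2 * (M : ℝ)⁻¹ else 0) + (M : ℝ)⁻¹ ^ 2 := by
      intro i hi
      rw [simplexVertex, if_pos (Finset.mem_range.1 hi)]
      split_ifs <;> ring
    rw [Finset.sum_congr rfl h, Finset.sum_add_distrib, Finset.sum_ite_eq',
      if_pos (Finset.mem_range.2 hw), Finset.sum_const, Finset.card_range, nsmul_eq_mul]
    field_simp
    ring
  · intro i _ hi
    rw [simplexVertex, if_neg (by simpa using hi)]
    simp

theorem exists_measurable_decoder {M : ℕ} (hM : 0 < M) {Ω : Type*} [MeasurableSpace Ω]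
    {G : Fin M → Set Ω} (hG : ∀ w, MeasurableSet (G w))
    (hd : ∀ w w', w ≠ w' → ∀ y ∈ G w, y ∉ G w') :
    ∃ d : Ω → Fin M, Measurable d ∧ ∀ w, ∀ y ∈ G w, d y = w := by
  have : Nonempty (Fin M) := ⟨⟨0, hM⟩⟩
  obtain ⟨d, hdm, h⟩ := exists_measurable_piecewise G hG (fun w _ => w)
    (fun w => measurable_const) fun w w' hne y hy => absurd hy.2 (hd w w' hne y hy.1)
  exact ⟨d, hdm, fun w y hy => h w hy⟩

/-- The decoder picks the largest of the first `M` outputs. The common offset `-1/M` cancels in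
differences, so `j` beats `w` only if a noise difference of variance `2` reaches `a`. -/
theorem exists_blockCode_errorProb_le {M n : ℕ} (hM : 0 < M) (hn : M ≤ n) {a P : ℝ} (ha : 0 ≤ a)
    (haP : a ^ 2 * (1 - (M : ℝ)⁻¹) ≤ n * P) :
    ∃ c : BlockCode M n, c.PeakEnergy P ∧
      c.errorProb ≤ ENNReal.ofReal (M * Real.exp (-(a ^ 2 / 4))) := by
  set ι : Fin M → Fin n := Fin.castLE hn with hι
  have hιinj : Function.Injective ι := Fin.castLE_injective hn
  obtain ⟨d, hdm, hd⟩ := exists_measurable_decoder hM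
    (G := fun w => {y : Fin n → ℝ | ∀ j, j ≠ w → y (ι j) < y (ι w)})
    (fun w => by
      simp only [Set.ofPred_forall]
      exact MeasurableSet.iInter fun j => MeasurableSet.iInter fun _ =>
        measurableSet_lt (measurable_pi_apply _) (measurable_pi_apply _))
    (fun w w' hne y hy hy' => lt_asymm (hy w' hne.symm) (hy' w hne))
  refine ⟨⟨fun w i => a * simplexVertex M w i, d, hdm⟩, fun w => ?_, ?_⟩
  · simp only [mul_pow, ← Finset.mul_sum]
    rwa [sum_simplexVertex_sq w.isLt hn]
  set ε := ENNReal.ofReal (Real.exp (-(a ^ 2 / 4)))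
  have hpair : ∀ w j : Fin M, j ≠ w →
      forwardNoise n {z | a ≤ z (ι j) - z (ι w)} ≤ ε := by
    intro w j hj
    have he : Function.Injective ![ι j, ι w] := by
      intro x y hxy
      fin_cases x <;> fin_cases y <;> simp_all [eq_comm]
    have h := forwardNoise_linear_tail he ![1, -1] ha (v := 2)
      (by simp [Fin.sum_univ_two]; norm_num)
    refine (measure_mono fun z hz => ?_).trans (h.trans (le_of_eq ?_))
    · simp only [Set.mem_ofPred_eq, Fin.sum_univ_two, Matrix.cons_val_zero,
        Matrix.cons_val_one] at hz ⊢
      linarith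
    · simp only [ε]
      congr 2
      ring
  have hmsg : ∀ w : Fin M,
      forwardNoise n {z | d (fun i => a * simplexVertex M w i + z i) ≠ w} ≤ M * ε := by
    intro w
    have hsub : {z : Fin n → ℝ | d (fun i => a * simplexVertex M w i + z i) ≠ w} ⊆
        ⋃ j : Fin M, {z | j ≠ w ∧ a ≤ z (ι j) - z (ι w)} := by
      intro z hz
      by_contra hcon
      refine hz (hd w _ fun j hj => ?_)
      by_contra hlt
      refine hcon (Set.mem_iUnion.2 ⟨j, hj, ?_⟩)
      have hjw : (j : ℕ) ≠ w := fun h => hj (Fin.ext h)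
      simp only [hι, Fin.val_castLE, simplexVertex, j.isLt, w.isLt, if_true, hjw, if_false,
        not_lt] at hlt ⊢
      linarith
    refine (measure_mono hsub).trans ((measure_iUnion_fintype_le _ _).trans ?_)
    refine (Finset.sum_le_card_nsmul _ _ ε fun j _ => ?_).trans (by simp)
    by_cases hj : j = w
    · simp [hj]
    · exact (measure_mono fun z hz => hz.2).trans (hpair w j hj)
  calc _ ≤ (M : ℝ≥0∞)⁻¹ * ∑ _w : Fin M, (M * ε) := by
        refine mul_le_mul_right (Finset.sum_le_sum fun w _ => hmsg w) _
    _ = M * ε := by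
        rw [Finset.sum_const, Finset.card_univ, Fintype.card_fin, nsmul_eq_mul, ← mul_assoc,
          ENNReal.inv_mul_cancel (by simp; omega) (by simp), one_mul]
    _ = _ := by
        rw [ENNReal.ofReal_mul (by positivity), ENNReal.ofReal_natCast]

theorem le_errorExponentNoFeedback {M : ℕ} (hM : 2 ≤ M) {P : ℝ} (hP : 0 < P) :
    (((M : ℝ) / (4 * ((M : ℝ) - 1)) * P : ℝ) : EReal) ≤ errorExponentNoFeedback M P := by
  have hM2 : (2 : ℝ) ≤ M := by exact_mod_cast hM
  have hM' : (0 : ℝ) < M - 1 := by linarith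
  refine le_limsup_neg_log_div M _ (by positivity) ?_
  filter_upwards [eventually_ge_atTop M] with n hn
  have ha : 0 ≤ n * (M * P / ((M : ℝ) - 1)) := by positivity
  obtain ⟨c, hc, hce⟩ := exists_blockCode_errorProb_le (P := P) (by omega : 0 < M) hn
    (Real.sqrt_nonneg (n * (M * P / ((M : ℝ) - 1)))) (by
      rw [Real.sq_sqrt ha]
      refine le_of_eq ?_
      field_simp)
  refine (iInf₂_le c hc).trans (hce.trans (le_of_eq ?_))
  rw [Real.sq_sqrt ha]
  congr 4
  field_simp

/-! ### Two-stage signalling with noisy feedback -/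

/-- `w` and `j` are the two strict leaders among the coordinates of `y`. -/
def IsLeadingPair {M : ℕ} (y : Fin M → ℝ) (w j : Fin M) : Prop :=
  ∀ k, k ≠ w → k ≠ j → y k < y w ∧ y k < y j

theorem measurableSet_isLeadingPair {M : ℕ} (w j : Fin M) :
    MeasurableSet {y : Fin M → ℝ | IsLeadingPair y w j} := by
  simp only [IsLeadingPair, Set.ofPred_forall]
  exact MeasurableSet.iInter fun k => MeasurableSet.iInter fun _ => MeasurableSet.iInter fun _ =>
    (measurableSet_lt (measurable_pi_apply k) (measurable_pi_apply w)).inter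
      (measurableSet_lt (measurable_pi_apply k) (measurable_pi_apply j))

/-- The sign with which the message `w` is resolved against the message `j`. -/
noncomputable def pairSign {M : ℕ} (w j : Fin M) : ℝ := if w < j then 1 else -1

theorem pairSign_swap {M : ℕ} {w j : Fin M} (h : w ≠ j) : pairSign j w = -pairSign w j := by
  rcases lt_or_gt_of_ne h with h | h <;> simp [pairSign, h, h.not_gt]

theorem pairSign_eq_or {M : ℕ} (w j : Fin M) : pairSign w j = 1 ∨ pairSign w j = -1 := by
  unfold pairSign; split_ifs <;> simp

open Classical in
/-- The amplitude-`b` antipodal signal resolving the two leading messages, as seen through the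
feedback `y`. -/
noncomputable def resolve {M : ℕ} (b : ℝ) (w : Fin M) (y : Fin M → ℝ) : ℝ :=
  if ∃ j, w < j ∧ IsLeadingPair y w j then b else -b

theorem measurable_resolve {M : ℕ} (b : ℝ) (w : Fin M) : Measurable (resolve b w) := by
  refine Measurable.ite ?_ measurable_const measurable_const
  simp only [Set.ofPred_exists]
  exact MeasurableSet.iUnion fun j =>
    (MeasurableSet.const _).inter (measurableSet_isLeadingPair w j)

theorem resolve_eq_or {M : ℕ} (b : ℝ) (w : Fin M) (y : Fin M → ℝ) :
    resolve b w y = b ∨ resolve b w y = -b := by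
  unfold resolve; split_ifs <;> simp

theorem resolve_sq {M : ℕ} (b : ℝ) (w : Fin M) (y : Fin M → ℝ) : resolve b w y ^ 2 = b ^ 2 := by
  rcases resolve_eq_or b w y with h | h <;> rw [h]; ring

/-- Strict leading makes the partner `j` of `w` unique. So if `j < w`, no larger partner exists and
`w` sends `-b`: the two leaders send opposite signs. -/
theorem pairSign_mul_resolve {M : ℕ} (b : ℝ) {w j : Fin M} (hj : j ≠ w) {y : Fin M → ℝ}
    (h : IsLeadingPair y w j) : pairSign w j * resolve b w y = b := by
  rcases lt_or_gt_of_ne hj with hlt | hlt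
  · have hnot : ¬∃ j', w < j' ∧ IsLeadingPair y w j' := by
      rintro ⟨j', hj', h'⟩
      have hne : j' ≠ j := fun e => lt_asymm hlt (e ▸ hj')
      exact lt_asymm (h j' hj'.ne' hne).2 (h' j hj hne.symm).2
    rw [resolve, if_neg hnot, pairSign, if_neg (lt_asymm hlt)]
    ring
  · rw [resolve, if_pos ⟨j, hlt, h⟩, pairSign, if_pos hlt, one_mul]

theorem neg_le_pairSign_mul_resolve {M : ℕ} {b : ℝ} (hb : 0 ≤ b) (w j : Fin M) (y : Fin M → ℝ) :
    -b ≤ pairSign w j * resolve b w y := by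
  rcases pairSign_eq_or w j with h | h <;> rcases resolve_eq_or b w y with h' | h' <;>
    rw [h, h'] <;> linarith

/-- The encoder sends a simplex vertex in the first `M` uses of the channel, then resolves the two
messages that lead in the feedback. -/
noncomputable def twoStageEnc {M n : ℕ} (b : ℝ) (i : Fin n) (w : Fin M) (y : Fin i → ℝ) : ℝ :=
  -- Times count from `0`, so at time `M` exactly the `M` first-stage feedback symbols are
  -- available. Later inputs are zero because `simplexVertex` vanishes there.
  if h : i.val = M then resolve b w fun j => y ⟨j, h ▸ j.isLt⟩
  else 10 * b * simplexVertex M w i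

theorem measurable_twoStageEnc {M n : ℕ} (b : ℝ) (i : Fin n) (w : Fin M) :
    Measurable (twoStageEnc b i w) := by
  unfold twoStageEnc
  split_ifs with h
  · exact (measurable_resolve b w).comp (measurable_pi_lambda _ fun j => measurable_pi_apply _)
  · exact measurable_const

/-- A positive margin means that `w` is preferred to `j`, given the outputs `y` of the first stage
and `s` of the second. -/
noncomputable def margin {M : ℕ} (w j : Fin M) (y : Fin M → ℝ) (s : ℝ) : ℝ :=
  5 * (y w - y j) + pairSign w j * s

/-- Antisymmetry makes the decoding regions disjoint. The weights `5, -5, ±1` form the matched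
filter: when `w` and `j` are the resolved pair, their signals differ by `10b, -10b, ±2b`. -/
theorem margin_swap {M : ℕ} {w j : Fin M} (h : w ≠ j) (y : Fin M → ℝ) (s : ℝ) :
    margin j w y s = -margin w j y s := by
  rw [margin, margin, pairSign_swap h]; ring

/-- The case of a correctly identified pair: the signal contributes `5 · 10b + b = 51b` to the
margin, against noise of variance `25 + 25 + 1 = 51`. -/
theorem noiseLaw_agreement_le {M n : ℕ} {α : ℝ≥0} {b : ℝ} (hb : 0 ≤ b)
    {ι : Fin M → Fin n} (hι : Function.Injective ι) {m : Fin n} (hm : ∀ j, ι j ≠ m)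
    {w j : Fin M} (hj : j ≠ w) :
    noiseLaw n α {ω | 51 * b ≤ 5 * (ω.1 (ι j) - ω.1 (ι w)) - pairSign w j * ω.1 m} ≤
      ENNReal.ofReal (Real.exp (-(51 / 2 * b ^ 2))) := by
  have he : Function.Injective ![ι j, ι w, m] := by
    have h1 := hι.ne hj; have h2 := hm j; have h3 := hm w
    intro x y hxy
    fin_cases x <;> fin_cases y <;> simp_all [eq_comm]
  have h := noiseLaw_linear_tail α he (f := (Fin.elim0 : Fin 0 → Fin n)) (fun i => i.elim0)
    ![5, -5, -pairSign w j] Fin.elim0 (t := 51 * b) (v := 51) (by positivity) (by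
      rcases pairSign_eq_or w j with hs | hs <;> rw [hs] <;> simp [Fin.sum_univ_three] <;> norm_num)
  refine (measure_mono fun ω hω => ?_).trans (h.trans (ENNReal.ofReal_le_ofReal
    (Real.exp_le_exp.2 ?_)))
  · simp [Fin.sum_univ_three] at hω ⊢
    linarith
  · ring_nf
    rfl

/-- A wrong last symbol leaves `50b - b = 49b` of margin. Adding twice the second inequality to the
first keeps the threshold `49b` but cuts the coefficient of `ω.1 (ι j)` from `5` to `3`. The
variance becomes `39 + 8α ≤ 41`, and `49²/82 > 51/2`. -/
theorem noiseLaw_overtaking_rival_le {M n : ℕ} {α : ℝ≥0} (hα : (α : ℝ) ≤ 1 / 4) {b : ℝ} (hb : 0 ≤ b)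
    {ι : Fin M → Fin n} (hι : Function.Injective ι) {m : Fin n} (hm : ∀ j, ι j ≠ m)
    {w j k : Fin M} (hj : j ≠ w) (hkw : k ≠ w) (hkj : k ≠ j) :
    noiseLaw n α {ω | 49 * b ≤ 5 * (ω.1 (ι j) - ω.1 (ι w)) - pairSign w j * ω.1 m ∧
        ω.1 (ι j) + ω.2 (ι j) ≤ ω.1 (ι k) + ω.2 (ι k)} ≤
      ENNReal.ofReal (Real.exp (-(51 / 2 * b ^ 2))) := by
  have h1 := hι.ne hj; have h2 := hι.ne hkw; have h3 := hι.ne hkj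
  have he : Function.Injective ![ι j, ι w, ι k, m] := by
    have h4 := hm j; have h5 := hm w; have h6 := hm k
    intro x y hxy
    fin_cases x <;> fin_cases y <;> simp_all [eq_comm]
  have hf : Function.Injective ![ι k, ι j] := by
    intro x y hxy
    fin_cases x <;> fin_cases y <;> simp_all [eq_comm]
  have h := noiseLaw_linear_tail α he hf ![3, -5, 2, -pairSign w j] ![2, -2]
    (t := 49 * b) (v := 41) (by positivity) (by
      rcases pairSign_eq_or w j with hs | hs <;> rw [hs] <;>
        simp [Fin.sum_univ_four] <;> linarith)
  refine (measure_mono fun ω hω => ?_).trans (h.trans (ENNReal.ofReal_le_ofReal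
    (Real.exp_le_exp.2 ?_)))
  · simp [Fin.sum_univ_four] at hω ⊢
    linarith [hω.1, hω.2]
  · nlinarith [sq_nonneg b]

/-- Here `k` must also overcome the lead `10b` of the true message. Adding twice the second
inequality raises the threshold to `69b`, with variance `79 + 8α ≤ 81`, and `69²/162 > 51/2`. -/
theorem noiseLaw_overtaking_sender_le {M n : ℕ} {α : ℝ≥0} (hα : (α : ℝ) ≤ 1 / 4) {b : ℝ} (hb : 0 ≤ b)
    {ι : Fin M → Fin n} (hι : Function.Injective ι) {m : Fin n} (hm : ∀ j, ι j ≠ m)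
    {w j k : Fin M} (hj : j ≠ w) (hkw : k ≠ w) (hkj : k ≠ j) :
    noiseLaw n α {ω | 49 * b ≤ 5 * (ω.1 (ι j) - ω.1 (ι w)) - pairSign w j * ω.1 m ∧
        10 * b + ω.1 (ι w) + ω.2 (ι w) ≤ ω.1 (ι k) + ω.2 (ι k)} ≤
      ENNReal.ofReal (Real.exp (-(51 / 2 * b ^ 2))) := by
  have h1 := hι.ne hj; have h2 := hι.ne hkw; have h3 := hι.ne hkj
  have he : Function.Injective ![ι j, ι w, ι k, m] := by
    have h4 := hm j; have h5 := hm w; have h6 := hm k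
    intro x y hxy
    fin_cases x <;> fin_cases y <;> simp_all [eq_comm]
  have hf : Function.Injective ![ι k, ι w] := by
    intro x y hxy
    fin_cases x <;> fin_cases y <;> simp_all [eq_comm]
  have h := noiseLaw_linear_tail α he hf ![5, -7, 2, -pairSign w j] ![2, -2]
    (t := 69 * b) (v := 81) (by positivity) (by
      rcases pairSign_eq_or w j with hs | hs <;> rw [hs] <;>
        simp [Fin.sum_univ_four] <;> linarith)
  refine (measure_mono fun ω hω => ?_).trans (h.trans (ENNReal.ofReal_le_ofReal
    (Real.exp_le_exp.2 ?_)))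
  · simp [Fin.sum_univ_four] at hω ⊢
    linarith [hω.1, hω.2]
  · nlinarith [sq_nonneg b]

theorem exists_feedbackCode_errorProb_le {M n : ℕ} (hM : 0 < M) (hn : M < n) {α : ℝ≥0}
    (hα : (α : ℝ) ≤ 1 / 4) {b P : ℝ} (hb : 0 ≤ b)
    (hbP : b ^ 2 * (100 * (1 - (M : ℝ)⁻¹) + 1) ≤ n * P) :
    ∃ c : FeedbackCode M n, c.PeakEnergy α P ∧
      c.errorProb α ≤ ENNReal.ofReal (M * (1 + 2 * M) * Real.exp (-(51 / 2 * b ^ 2))) := by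
  set ι : Fin M → Fin n := Fin.castLE hn.le with hι
  set m : Fin n := ⟨M, hn⟩ with hm
  have hιinj : Function.Injective ι := Fin.castLE_injective hn.le
  have hιm : ∀ j, ι j ≠ m := fun j h => j.isLt.ne (congrArg Fin.val h)
  have hmarg : ∀ w j : Fin M,
      Measurable fun y : Fin n → ℝ => margin w j (fun k => y (ι k)) (y m) := by
    intro w j
    unfold margin
    fun_prop
  obtain ⟨d, hdm, hd⟩ := exists_measurable_decoder hM
    (G := fun w => {y : Fin n → ℝ | ∀ j, j ≠ w → 0 < margin w j (fun k => y (ι k)) (y m)})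
    (fun w => by
      simp only [Set.ofPred_forall]
      exact MeasurableSet.iInter fun j => MeasurableSet.iInter fun _ =>
        measurableSet_lt measurable_const (hmarg w j))
    (fun w w' hne y hy hy' => by
      have h1 := hy w' hne.symm
      have h2 := hy' w hne
      rw [margin_swap hne] at h2
      linarith)
  set c : FeedbackCode M n := ⟨twoStageEnc b, d, measurable_twoStageEnc b, hdm⟩ with hc
  have hin : ∀ w z z' (i : Fin n), i ≠ m →
      c.input w z z' i = 10 * b * simplexVertex M w i := by
    intro w z z' i hi
    rw [FeedbackCode.input]
    exact dif_neg fun h => hi (Fin.ext h)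
  have hinm : ∀ w z z', c.input w z z' m = resolve b w fun j =>
      10 * b * simplexVertex M w j + z (ι j) + z' (ι j) := by
    intro w z z'
    rw [FeedbackCode.input]
    refine (dif_pos rfl).trans ?_
    congr 1
    ext j
    exact congrArg (fun x => x + z (ι j) + z' (ι j)) (hin w z z' (ι j) (hιm j))
  refine ⟨c, fun w => Eventually.of_forall fun ω => ?_, ?_⟩
  · have hle : ∀ i, c.input w ω.1 ω.2 i ^ 2 ≤
        100 * b ^ 2 * simplexVertex M w i ^ 2 + if i = m then b ^ 2 else 0 := by
      intro i
      by_cases hi : i = m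
      · rw [if_pos hi, hi, hinm, resolve_sq]
        have : 0 ≤ 100 * b ^ 2 * simplexVertex M w m ^ 2 := by positivity
        linarith
      · rw [if_neg hi, hin _ _ _ _ hi]
        exact le_of_eq (by ring)
    refine (Finset.sum_le_sum fun i _ => hle i).trans (le_trans (le_of_eq ?_) hbP)
    rw [Finset.sum_add_distrib, ← Finset.mul_sum, sum_simplexVertex_sq w.isLt hn.le]
    simp
    ring
  set ε := ENNReal.ofReal (Real.exp (-(51 / 2 * b ^ 2))) with hε
  have hvw : ∀ w : Fin M, simplexVertex M w w = 1 - (M : ℝ)⁻¹ := fun w => by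
    simp [simplexVertex]
  have hvj : ∀ w j : Fin M, j ≠ w → simplexVertex M w j = -(M : ℝ)⁻¹ := fun w j hj => by
    have : (j : ℕ) ≠ w := fun h => hj (Fin.ext h)
    simp [simplexVertex, this]
  have hpair : ∀ w j : Fin M, j ≠ w → noiseLaw n α {ω | margin w j
      (fun k => c.output w ω.1 ω.2 (ι k)) (c.output w ω.1 ω.2 m) ≤ 0} ≤ (1 + 2 * M) * ε := by
    intro w j hj
    set A := {ω : (Fin n → ℝ) × (Fin n → ℝ) |
      51 * b ≤ 5 * (ω.1 (ι j) - ω.1 (ι w)) - pairSign w j * ω.1 m}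
    set B : Fin M → Set ((Fin n → ℝ) × (Fin n → ℝ)) := fun k =>
      {ω | (k ≠ w ∧ k ≠ j) ∧ 49 * b ≤ 5 * (ω.1 (ι j) - ω.1 (ι w)) - pairSign w j * ω.1 m ∧
        ω.1 (ι j) + ω.2 (ι j) ≤ ω.1 (ι k) + ω.2 (ι k)}
    set C : Fin M → Set ((Fin n → ℝ) × (Fin n → ℝ)) := fun k =>
      {ω | (k ≠ w ∧ k ≠ j) ∧ 49 * b ≤ 5 * (ω.1 (ι j) - ω.1 (ι w)) - pairSign w j * ω.1 m ∧
        10 * b + ω.1 (ι w) + ω.2 (ι w) ≤ ω.1 (ι k) + ω.2 (ι k)}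
    have hsub : {ω | margin w j (fun k => c.output w ω.1 ω.2 (ι k)) (c.output w ω.1 ω.2 m) ≤ 0} ⊆
        A ∪ ((⋃ k, B k) ∪ ⋃ k, C k) := by
      intro ω hω
      simp only [Set.mem_ofPred_eq, margin, FeedbackCode.output, hinm, hin _ _ _ _ (hιm _)] at hω
      simp only [hι, Fin.val_castLE, hvw, hvj w j hj] at hω
      rw [← hι, mul_add (pairSign w j)] at hω
      -- Only the sender's view of the pair matters. If `w` and `j` do not lead, some third `k` has
      -- overtaken `w` or `j` in the feedback, and the last symbol costs at most `b`.
      by_cases hlead : IsLeadingPair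
          (fun j => 10 * b * simplexVertex M w j + ω.1 (ι j) + ω.2 (ι j)) w j
      · rw [pairSign_mul_resolve b hj hlead] at hω
        left
        simp only [A, Set.mem_ofPred_eq]
        linarith
      · have hneg := neg_le_pairSign_mul_resolve hb w j
          (fun j => 10 * b * simplexVertex M w j + ω.1 (ι j) + ω.2 (ι j))
        have h49 : 49 * b ≤ 5 * (ω.1 (ι j) - ω.1 (ι w)) - pairSign w j * ω.1 m := by linarith
        right
        simp only [IsLeadingPair, not_forall, not_and_or, not_lt] at hlead
        obtain ⟨k, hkw, hkj, h | h⟩ := hlead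
        · right
          rw [hvw, hvj w k hkw] at h
          exact Set.mem_iUnion.2 ⟨k, ⟨hkw, hkj⟩, h49, by linarith⟩
        · left
          rw [hvj w j hj, hvj w k hkw] at h
          exact Set.mem_iUnion.2 ⟨k, ⟨hkw, hkj⟩, h49, by linarith⟩
    have hB : noiseLaw n α (⋃ k, B k) ≤ M * ε := by
      refine (measure_iUnion_fintype_le _ _).trans
        ((Finset.sum_le_card_nsmul _ _ ε fun k _ => ?_).trans (by simp))
      by_cases hk : k ≠ w ∧ k ≠ j
      · exact (measure_mono fun ω hω => hω.2).trans
          (noiseLaw_overtaking_rival_le hα hb hιinj hιm hj hk.1 hk.2)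
      · simp [B, hk]
    have hC : noiseLaw n α (⋃ k, C k) ≤ M * ε := by
      refine (measure_iUnion_fintype_le _ _).trans
        ((Finset.sum_le_card_nsmul _ _ ε fun k _ => ?_).trans (by simp))
      by_cases hk : k ≠ w ∧ k ≠ j
      · exact (measure_mono fun ω hω => hω.2).trans
          (noiseLaw_overtaking_sender_le hα hb hιinj hιm hj hk.1 hk.2)
      · simp [C, hk]
    refine (measure_mono hsub).trans ((measure_union_le _ _).trans ((add_le_add
      (noiseLaw_agreement_le hb hιinj hιm hj) ((measure_union_le _ _).trans
        (add_le_add hB hC))).trans (le_of_eq ?_)))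
    ring
  have hmsg : ∀ w : Fin M, noiseLaw n α {ω | c.dec (c.output w ω.1 ω.2) ≠ w} ≤
      M * ((1 + 2 * M) * ε) := by
    intro w
    have hsub : {ω : (Fin n → ℝ) × (Fin n → ℝ) | c.dec (c.output w ω.1 ω.2) ≠ w} ⊆
        ⋃ j : Fin M, {ω | j ≠ w ∧ margin w j
          (fun k => c.output w ω.1 ω.2 (ι k)) (c.output w ω.1 ω.2 m) ≤ 0} := by
      intro ω hω
      by_contra hcon
      refine hω (hd w _ fun j hj => ?_)
      by_contra hle
      exact hcon (Set.mem_iUnion.2 ⟨j, hj, not_lt.1 hle⟩)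
    refine (measure_mono hsub).trans ((measure_iUnion_fintype_le _ _).trans ?_)
    refine (Finset.sum_le_card_nsmul _ _ ((1 + 2 * M) * ε) fun j _ => ?_).trans (by simp)
    by_cases hj : j = w
    · simp [hj]
    · exact (measure_mono fun ω hω => hω.2).trans (hpair w j hj)
  calc _ ≤ (M : ℝ≥0∞)⁻¹ * ∑ _w : Fin M, (M * ((1 + 2 * M) * ε)) := by
        refine mul_le_mul_right (Finset.sum_le_sum fun w _ => hmsg w) _
    _ = M * ((1 + 2 * M) * ε) := by
        rw [Finset.sum_const, Finset.card_univ, Fintype.card_fin, nsmul_eq_mul, ← mul_assoc,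
          ENNReal.inv_mul_cancel (by simp; omega) (by simp), one_mul]
    _ = _ := by
        rw [ENNReal.ofReal_mul (by positivity), ENNReal.ofReal_mul (by positivity),
          ENNReal.ofReal_add (by positivity) (by positivity), ENNReal.ofReal_mul (by positivity),
          ENNReal.ofReal_natCast, ENNReal.ofReal_one, ENNReal.ofReal_ofNat, mul_assoc]

/-! ### Comparison of the exponents. -/

theorem le_errorExponent {M : ℕ} (hM : 0 < M) {P : ℝ} (hP : 0 < P) {α : ℝ≥0}
    (hα : (α : ℝ) ≤ 1 / 4) :
    ((51 / 2 * (P / (100 * (1 - (M : ℝ)⁻¹) + 1)) : ℝ) : EReal) ≤ errorExponent M α P := by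
  have hM1 : (1 : ℝ) ≤ M := by exact_mod_cast hM
  have hden : 0 < 100 * (1 - (M : ℝ)⁻¹) + 1 := by
    have := inv_le_one_of_one_le₀ hM1
    linarith
  refine le_limsup_neg_log_div (M * (1 + 2 * M)) _ (by positivity) ?_
  filter_upwards [eventually_gt_atTop M] with n hn
  have hb : 0 ≤ n * (P / (100 * (1 - (M : ℝ)⁻¹) + 1)) := by positivity
  obtain ⟨c, hc, hce⟩ := exists_feedbackCode_errorProb_le (P := P) hM hn hα
    (Real.sqrt_nonneg (n * (P / (100 * (1 - (M : ℝ)⁻¹) + 1)))) (by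
      rw [Real.sq_sqrt hb, mul_assoc, div_mul_cancel₀ _ hden.ne'])
  refine (iInf₂_le c hc).trans (hce.trans (le_of_eq ?_))
  rw [Real.sq_sqrt hb]
  congr 4
  ring

theorem corollary1 (M : ℕ) (hM : 3 ≤ M) (P : ℝ) (hP : 0 < P) (α : ℝ≥0) (hα : (α : ℝ) < 1 / 4) :
    errorExponentNoFeedback M P = (((M : ℝ) / (4 * ((M : ℝ) - 1)) * P : ℝ) : EReal) ∧
      errorExponentNoFeedback M P < errorExponent M α P := by
  have hM3 : (3 : ℝ) ≤ M := by exact_mod_cast hM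
  have heq := le_antisymm (errorExponentNoFeedback_le (by omega : 2 ≤ M) hP)
    (le_errorExponentNoFeedback (by omega) hP)
  refine ⟨heq, heq ▸ lt_of_lt_of_le (EReal.coe_lt_coe_iff.2 ?_)
    (le_errorExponent (by omega) hP hα.le)⟩
  have hM' : (0 : ℝ) < M - 1 := by linarith
  have hden : 100 * (1 - (M : ℝ)⁻¹) + 1 = (101 * M - 100) / M := by
    field_simp
    ring
  -- After clearing denominators the claim is `101M - 100 < 102(M - 1)`, that is `M > 2`.
  rw [hden, div_div_eq_mul_div, div_mul_eq_mul_div, ← mul_div_assoc,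
    div_lt_div_iff₀ (by linarith) (by linarith)]
  have hMP : 0 < (M : ℝ) * P := by positivity
  nlinarith [mul_pos hMP hM']
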